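/- Let $n,m,\ell,q\in\mathbb N$, and let $F,f,h_1,\dots,h_\ell,g_1,\dots,g_q\colon\mathbb R^n\times\mathbb R^m\to\mathbb R$ be continuously differentiable and $X\subset\mathbb R^n$ closed. For $x\in\mathbb R^n$ put \[ \Gamma(x):=\{y\in\mathbb R^m\mid h_i(x,y)\le 0\ (i=1,\dots,\ell),\ g_j(x,y)=0\ (j=1,\dots,q)\}, \] \[ \varphi(x):=\inf_y\{f(x,y)\mid y\in\Gamma(x)\}\in[-\infty,\infty],\qquad S(x):=\operatorname{argmin}_y\{f(x,y)\mid y\in\Gamma(x)\}, \] $\operatorname{dom}\Gamma:=\{x\mid\Gamma(x)\ne\varnothing\}$ and $h_0(x,y):=f(x,y)-\varphi(x)$. Consider the optimistic bilevel problem \[ \min_{x,y}\{F(x,y)\mid x\in X,\ y\in S(x)\}.\tag{BPP$'$} \] Definitions. A pair of finite families of vectors $((a^i)_{i\in K},(b^j)_{j\in B})$ is positive-linearly dependent if there are $\alpha_i\ge0$ ($i\in K$) and $\beta_j\in\mathbb R$ ($j\in B$), not all zero, with $\sum_{i\in K}\alpha_ia^i+\sum_{j\in B}\beta_jb^j=0$.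 For $\bar y\in S(\bar x)$, RCPLD$_S$ w.r.t. $\operatorname{dom}\Gamma$ holds at $(\bar x,\bar y)$ if there are a neighborhood $U$ of $(\bar x,\bar y)$ and a set $B\subset\{1,\dots,q\}$ such that (i) the family $(\nabla_yg_j(\bar x,\bar y))_{j\in B}$ is a basis of the span of $\{\nabla_yg_j(\bar x,\bar y)\mid j=1,\dots,q\}$; (ii) the family $(\nabla_yg_j(x,y))_{j=1}^q$ has constant rank on $U\cap(\operatorname{dom}\Gamma\times\mathbb R^m)$; (iii) for each $K\subset\{i\in\{0,1,\dots,\ell\}\mid h_i(\bar x,\bar y)=0\}$ such that $\bigl((\nabla_yh_i(\bar x,\bar y))_{i\in K},(\nabla_yg_j(\bar x,\bar y))_{j\in B}\bigr)$ is positive-linearly dependent, the family consisting of all $\nabla_yh_i(x,y)$, $i\in K$, and all $\nabla_yg_j(x,y)$, $j\in B$, is linearly dependent for every $(x,y)\in U\cap(\operatorname{dom}\Gamma\times\mathbb R^m)$. $S$ is inner semicontinuous at $(\bar x,\bar y)$ w.r.t. $\operatorname{dom}\Gamma$ if for each sequence $(x^k)\subset\operatorname{dom}\Gamma$ with $x^k\to\bar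 x$ there is a sequence $y^k\to\bar y$ with $y^k\in S(x^k)$ for all sufficiently large $k$. (BPP$'$) is partially calm at its local minimizer $(\bar x,\bar y)$ if there are a neighborhood $U$ of $(\bar x,\bar y,0)\in\mathbb R^n\times\mathbb R^m\times\mathbb R$ and $\kappa>0$ such that $F(x,y)-F(\bar x,\bar y)+\kappa|u|\ge0$ for all $(x,y,u)\in U$ with $x\in X$, $f(x,y)-\varphi(x)\le u$ and $y\in\Gamma(x)$. Theorem. Let $(\bar x,\bar y)$ be a local minimizer of (BPP$'$), and let one of the following conditions hold. (a) For each $x\in\mathbb R^n$, the functions $f(x,\cdot)$ and $h_1(x,\cdot),\dots,h_\ell(x,\cdot)$ are convex and $g_1(x,\cdot),\dots,g_q(x,\cdot)$ are affine; there are a neighborhood $V$ of $\bar x$ and a bounded set $D\subset\mathbb R^m$ with $\Gamma(x)\subset D$ for all $x\in V$; and RCPLD$_S$ w.r.t. $\operatorname{dom}\Gamma$ holds at each point of $\{\bar x\}\times S(\bar x)$. (b) $S$ is inner semicontinuous at $(\bar x,\bar y)$ w.r.t. $\operatorname{dom}\Gamma$, and RCPLD$_S$ w.r.t. $\operatorname{dom}\Gamma$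 holds at $(\bar x,\bar y)$. Then (BPP$'$) is partially calm at $(\bar x,\bar y)$. -/

import Mathlib

open Filter Topology

noncomputable section

namespace Bilevel

/-- The space `ℝⁿ` with the Euclidean norm. -/
abbrev Vec (n : ℕ) : Type := EuclideanSpace ℝ (Fin n)

/-- The pair of finite families `(a, b)` is positive-linearly dependent: there are scalars
`α i ≥ 0` and `β j`, not all vanishing, with `∑ α i • a i + ∑ β j • b j = 0`. -/
def PosLinDep {I J V : Type*} [Fintype I] [Fintype J] [AddCommGroup V] [Module ℝ V]
    (a : I → V) (b : J → V) : Prop :=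
  ∃ (α : I → ℝ) (β : J → ℝ), (∀ i, 0 ≤ α i) ∧ ((∃ i, α i ≠ 0) ∨ ∃ j, β j ≠ 0) ∧
    ∑ i, α i • a i + ∑ j, β j • b j = 0

/-- Domain of a set-valued mapping. -/
def dom {n m : ℕ} (Υ : Vec n → Set (Vec m)) : Set (Vec n) := {x | (Υ x).Nonempty}

/-- Local boundedness of a set-valued mapping at `x₀`. -/
def LocallyBoundedAt {n m : ℕ} (Υ : Vec n → Set (Vec m)) (x₀ : Vec n) : Prop :=
  ∃ B : Set (Vec m), Bornology.IsBounded B ∧ ∃ U ∈ 𝓝 x₀, ∀ x ∈ U, Υ x ⊆ B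

/-- Inner semicontinuity of a set-valued mapping at `(x₀, y₀)` with respect to `Ω`. -/
def InnerSemicontinuousAt {n m : ℕ} (Υ : Vec n → Set (Vec m)) (Ω : Set (Vec n))
    (x₀ : Vec n) (y₀ : Vec m) : Prop :=
  ∀ xs : ℕ → Vec n, (∀ k, xs k ∈ Ω) → Tendsto xs atTop (𝓝 x₀) →
    ∃ ys : ℕ → Vec m, Tendsto ys atTop (𝓝 y₀) ∧ ∀ᶠ k in atTop, ys k ∈ Υ (xs k)

/-- The partial gradient `∇_y h (x, y)` of an extended-real-valued function, meaningful where
`h (x, ·)` is finite near `y`. -/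
def gradY {n m : ℕ} (h : Vec n → Vec m → EReal) (x : Vec n) (y : Vec m) : Vec m :=
  gradient (fun y' => (h x y').toReal) y

/-- The relaxed constant positive linear dependence constraint qualification at `(x₀, y₀)` with
respect to `Ω`, for the system `h i (x, y) ≤ 0` (`i : I`), `g j (x, y) = 0` (`j : J`). -/
def RCPLD {n m : ℕ} {I J : Type*}
    (h : I → Vec n → Vec m → EReal) (g : J → Vec n → Vec m → EReal)
    (Ω : Set (Vec n)) (x₀ : Vec n) (y₀ : Vec m) : Prop :=
  ∃ U ∈ 𝓝 (x₀, y₀), ∃ B : Finset J,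
    -- the gradients with index in `B` are a basis of the span of all equality gradients
    (LinearIndependent ℝ (fun j : B => gradY (g j) x₀ y₀) ∧
      Submodule.span ℝ (Set.range fun j : B => gradY (g j) x₀ y₀) =
        Submodule.span ℝ (Set.range fun j : J => gradY (g j) x₀ y₀)) ∧
    -- the family of all equality gradients has constant rank
    (∃ r : ℕ, ∀ x y, (x, y) ∈ U → x ∈ Ω →
      Module.finrank ℝ (Submodule.span ℝ (Set.range fun j : J => gradY (g j) x y)) = r) ∧
    -- positive linear dependence at the reference point enforces linear dependence nearby
    (∀ K : Finset I, (∀ i ∈ K, h i x₀ y₀ = 0) →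
      PosLinDep (fun i : K => gradY (h i) x₀ y₀) (fun j : B => gradY (g j) x₀ y₀) →
      ∀ x y, (x, y) ∈ U → x ∈ Ω →
        ¬ LinearIndependent ℝ
          (Sum.elim (fun i : K => gradY (h i) x y) (fun j : B => gradY (g j) x y)))

section LowerLevel

variable {n m l q : ℕ} (f : Vec n → Vec m → ℝ)
  (h : Fin l → Vec n → Vec m → ℝ) (g : Fin q → Vec n → Vec m → ℝ)

/-- The feasible set mapping `Γ` of the lower level problem. -/
def feasMap (x : Vec n) : Set (Vec m) :=
  {y | (∀ i, h i x y ≤ 0) ∧ ∀ j, g j x y = 0}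

/-- The solution mapping `S` of the lower level problem `min_y {f (x, y) | y ∈ Γ x}`. -/
def solMap (x : Vec n) : Set (Vec m) :=
  {y | y ∈ feasMap h g x ∧ ∀ y' ∈ feasMap h g x, f x y ≤ f x y'}

/-- The optimal value function `φ` of the lower level problem, with values in `[-∞, ∞]`. -/
def valueFun (x : Vec n) : EReal := ⨅ y ∈ feasMap h g x, (f x y : EReal)

/-- The inequality constraints of `S`: the index `none` carries the value function constraint
`f (x, y) - φ x ≤ 0`, the index `some i` carries `h i (x, y) ≤ 0`. -/
def solIneq : Option (Fin l) → Vec n → Vec m → EReal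
  | none, x, y => (f x y : EReal) - valueFun f h g x
  | some i, x, y => (h i x y : EReal)

/-- RCPLD for the representation of `S` by `f - φ ≤ 0`, `h i ≤ 0`, `g j = 0`. -/
def RCPLDSol (Ω : Set (Vec n)) (x₀ : Vec n) (y₀ : Vec m) : Prop :=
  RCPLD (solIneq f h g) (fun j x y => (g j x y : EReal)) Ω x₀ y₀

/-- For each `x`, `f (x, ·)` and the `h i (x, ·)` are convex and the `g j (x, ·)` are affine. -/
def ConvexData : Prop :=
  ∀ x, ConvexOn ℝ Set.univ (f x) ∧ (∀ i, ConvexOn ℝ Set.univ (h i x)) ∧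
    ∀ j, ∃ A : Vec m →ᵃ[ℝ] ℝ, ∀ y, g j x y = A y

/-- `(x₀, y₀)` is a local minimizer of `min_{x,y} {F (x, y) | x ∈ X, y ∈ S x}`. -/
def IsLocalMinimizer (F : Vec n → Vec m → ℝ) (X : Set (Vec n)) (x₀ : Vec n) (y₀ : Vec m) : Prop :=
  (x₀ ∈ X ∧ y₀ ∈ solMap f h g x₀) ∧
    ∃ U ∈ 𝓝 (x₀, y₀), ∀ x y, (x, y) ∈ U → x ∈ X → y ∈ solMap f h g x → F x₀ y₀ ≤ F x y

/-- Partial calmness of `min_{x,y} {F (x, y) | x ∈ X, y ∈ S x}` at `(x₀, y₀)`. -/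
def PartiallyCalmAt (F : Vec n → Vec m → ℝ) (X : Set (Vec n)) (x₀ : Vec n) (y₀ : Vec m) : Prop :=
  ∃ U ∈ 𝓝 (x₀, y₀, (0 : ℝ)), ∃ κ : ℝ, 0 < κ ∧ ∀ x y u, (x, y, u) ∈ U →
    x ∈ X → (f x y : EReal) - valueFun f h g x ≤ (u : EReal) → y ∈ feasMap h g x →
      0 ≤ F x y - F x₀ y₀ + κ * |u|

end LowerLevel

end Bilevel

end

/-! Partial calmness is exact penalization of `f - φ ≤ 0`. Since `F` is locally Lipschitz, it
follows from an error bound `‖p - y‖ ≤ κ * u` (`ValueErrorBoundAt`): a point `p` of `Γ x` that is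
`u`-optimal and near `y₀` has a true solution `y` nearby, and `F x₀ y₀ ≤ F x y` by local minimality.

For the error bound let `y` be the projection of `p` onto `S x`. KKT conditions write `p - y` as a
combination of constraint gradients at `y`. Pairing this with `p - y` bounds `‖p - y‖ ^ 2` by the
multiplier of `f` times `f x p - f x y`, up to linearization errors, because active `h i` and all `g
j` contribute nothing positive to first order. If the multipliers are at most `M * ‖p - y‖`, one
factor cancels (`norm_sub_le_of_kkt`).

RCPLD supplies such multipliers. A quadratic penalty gives approximate KKT conditions without any
constraint qualification. Carathéodory reduction makes the gradients in use linearly independent; by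
RCPLD they cannot then be positive-linearly dependent at the reference point, and compactness bounds
their coefficients (`exists_bounded_multipliers`).

Under (b), inner semicontinuity keeps `y` close to `y₀`, so the linearization errors are absorbed.
Under (a), `y` need only cluster somewhere in `S x₀`, but convexity removes the errors altogether.
-/

noncomputable section

namespace Bilevel

/-! ### Bounded multipliers from positive linear independence and constant rank -/

section Multipliers

variable {I J V : Type*} [Fintype I] [Fintype J] [NormedAddCommGroup V] [NormedSpace ℝ V]

/-- The norm of the combination is positive on the compact set of unit multipliers with `α ≥ 0`, so
it has a positive minimum there; homogeneity extends the bound. -/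
theorem exists_coercive_of_not_posLinDep {a : I → V} {b : J → V} (hab : ¬ PosLinDep a b) :
    ∃ c : ℝ, 0 < c ∧ ∀ (α : I → ℝ) (β : J → ℝ), (∀ i, 0 ≤ α i) →
      c * ‖(α, β)‖ ≤ ‖∑ i, α i • a i + ∑ j, β j • b j‖ := by
  set T : Set ((I → ℝ) × (J → ℝ)) := Metric.sphere 0 1 ∩ {z | ∀ i, 0 ≤ z.1 i} with hT
  have hTc : IsCompact T := by
    refine (isCompact_sphere _ _).inter_right ?_
    simp only [Set.ofPred_forall]
    exact isClosed_iInter fun i => isClosed_le continuous_const (by fun_prop)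
  have hφ : Continuous fun z : (I → ℝ) × (J → ℝ) =>
      ‖∑ i, z.1 i • a i + ∑ j, z.2 j • b j‖ := by fun_prop
  have key : ∃ c : ℝ, 0 < c ∧ ∀ z ∈ T, c ≤ ‖∑ i, z.1 i • a i + ∑ j, z.2 j • b j‖ := by
    rcases T.eq_empty_or_nonempty with h | h
    -- This case occurs when both index types are empty: the unit sphere is then void.
    · exact ⟨1, one_pos, by simp [h]⟩
    · obtain ⟨z, hz, hmin⟩ := hTc.exists_isMinOn h hφ.continuousOn
      refine ⟨_, ?_, fun w hw => hmin hw⟩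
      rw [norm_pos_iff]
      intro h0
      refine hab ⟨z.1, z.2, hz.2, ?_, h0⟩
      by_contra! hne
      have : z = 0 := Prod.ext (funext hne.1) (funext hne.2)
      have h1 := hz.1
      simp [this] at h1
  obtain ⟨c, hc, hcT⟩ := key
  refine ⟨c, hc, fun α β hα => ?_⟩
  by_cases h0 : ‖(α, β)‖ = 0
  · rw [h0, mul_zero]; exact norm_nonneg _
  have hpos : 0 < ‖(α, β)‖ := lt_of_le_of_ne (norm_nonneg _) (Ne.symm h0)
  have hmem : (‖(α, β)‖⁻¹ • (α, β) : (I → ℝ) × (J → ℝ)) ∈ T := by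
    refine ⟨?_, fun i => ?_⟩
    · rw [mem_sphere_zero_iff_norm, norm_smul, norm_inv, norm_norm, inv_mul_cancel₀ h0]
    · exact mul_nonneg (inv_nonneg.2 (norm_nonneg _)) (hα i)
  have h1 := hcT _ hmem
  have h2 : ∑ i, (‖(α, β)‖⁻¹ • (α, β) : (I → ℝ) × (J → ℝ)).1 i • a i +
      ∑ j, (‖(α, β)‖⁻¹ • (α, β) : (I → ℝ) × (J → ℝ)).2 j • b j =
      ‖(α, β)‖⁻¹ • (∑ i, α i • a i + ∑ j, β j • b j) := by
    simp [Finset.smul_sum, smul_add, smul_smul]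
  rw [h2, norm_smul, norm_inv, norm_norm] at h1
  rwa [inv_mul_eq_div, le_div_iff₀ hpos] at h1

theorem norm_sum_smul_add_le (α : I → ℝ) (β : J → ℝ) (a : I → V) (b : J → V) :
    ‖∑ i, α i • a i + ∑ j, β j • b j‖ ≤ ‖(α, β)‖ * (∑ i, ‖a i‖ + ∑ j, ‖b j‖) := by
  rw [mul_add, Finset.mul_sum, Finset.mul_sum]
  refine (norm_add_le _ _).trans (add_le_add ?_ ?_)
  · refine (norm_sum_le _ _).trans (Finset.sum_le_sum fun i _ => ?_)
    rw [norm_smul]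
    gcongr
    exact (norm_le_pi_norm α i).trans (norm_fst_le (α, β))
  · refine (norm_sum_le _ _).trans (Finset.sum_le_sum fun i _ => ?_)
    rw [norm_smul]
    gcongr
    exact (norm_le_pi_norm β i).trans (norm_snd_le (α, β))

/-- Half of the constant at `p₀` is spent on the perturbation of the vectors, which costs at most
`‖(α, β)‖` times their total displacement. -/
theorem eventually_coercive_of_not_posLinDep {P : Type*} [TopologicalSpace P] {p₀ : P}
    {a : I → P → V} {b : J → P → V} (ha : ∀ i, ContinuousAt (a i) p₀)
    (hb : ∀ j, ContinuousAt (b j) p₀)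
    (hab : ¬ PosLinDep (fun i => a i p₀) (fun j => b j p₀)) :
    ∃ c : ℝ, 0 < c ∧ ∀ᶠ p in 𝓝 p₀, ∀ (α : I → ℝ) (β : J → ℝ), (∀ i, 0 ≤ α i) →
      c * ‖(α, β)‖ ≤ ‖∑ i, α i • a i p + ∑ j, β j • b j p‖ := by
  obtain ⟨c, hc, hcoer⟩ := exists_coercive_of_not_posLinDep hab
  refine ⟨c / 2, half_pos hc, ?_⟩
  have hcont : ContinuousAt (fun p => ∑ i, ‖a i p - a i p₀‖ + ∑ j, ‖b j p - b j p₀‖) p₀ := by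
    fun_prop
  have hlt : ∀ᶠ p in 𝓝 p₀, ∑ i, ‖a i p - a i p₀‖ + ∑ j, ‖b j p - b j p₀‖ < c / 2 :=
    hcont.eventually_lt continuousAt_const (by simpa using hc)
  filter_upwards [hlt] with p hp α β hα
  have h1 := hcoer α β hα
  have h2 := norm_sum_smul_add_le α β (fun i => a i p - a i p₀) (fun j => b j p - b j p₀)
  have h3 : ∑ i, α i • (a i p - a i p₀) + ∑ j, β j • (b j p - b j p₀) =
      (∑ i, α i • a i p + ∑ j, β j • b j p) - (∑ i, α i • a i p₀ + ∑ j, β j • b j p₀) := by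
    simp only [smul_sub, Finset.sum_sub_distrib]; abel
  rw [h3] at h2
  have h4 := norm_sub_norm_le (∑ i, α i • a i p₀ + ∑ j, β j • b j p₀)
    (∑ i, α i • a i p + ∑ j, β j • b j p)
  rw [norm_sub_rev] at h4
  have h5 := mul_le_mul_of_nonneg_left hp.le (norm_nonneg (α, β))
  linarith

/-- Carathéodory reduction of a conic combination of `a` plus a linear combination of the
linearly independent family `b`. -/
theorem exists_linearIndependent_combination {I J V : Type*} [Fintype J] [AddCommGroup V]
    [Module ℝ V] (a : I → V) {b : J → V}
    (hb : LinearIndependent ℝ b) (K : Finset I) :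
    ∀ (α : I → ℝ) (β : J → ℝ), (∀ i, 0 ≤ α i) →
      ∃ K' ⊆ K, ∃ (α' : I → ℝ) (β' : J → ℝ), (∀ i, 0 ≤ α' i) ∧
        LinearIndependent ℝ (Sum.elim (fun i : K' => a i) b) ∧
        ∑ i ∈ K', α' i • a i + ∑ j, β' j • b j = ∑ i ∈ K, α i • a i + ∑ j, β j • b j := by
  classical
  induction K using Finset.strongInduction with
  | H K ih =>
  intro α β hα
  by_cases hLI : LinearIndependent ℝ (Sum.elim (fun i : K => a i) b)
  · exact ⟨K, subset_rfl, α, β, hα, hLI, rfl⟩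
  -- Independence of `b` forces any nontrivial relation to involve some `a i`.
  have hdep : ∃ (γ : I → ℝ) (δ : J → ℝ),
      ∑ i ∈ K, γ i • a i + ∑ j, δ j • b j = 0 ∧ ∃ i ∈ K, γ i ≠ 0 := by
    obtain ⟨w, hw, s, hs⟩ := Fintype.not_linearIndependent_iff.1 hLI
    rw [Fintype.sum_sum_type] at hw
    simp only [Sum.elim_inl, Sum.elim_inr] at hw
    refine ⟨fun i => if hi : i ∈ K then w (Sum.inl ⟨i, hi⟩) else 0, fun j => w (Sum.inr j), ?_, ?_⟩
    · rw [← hw, ← Finset.sum_coe_sort K]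
      simp
    · by_contra! hzero
      have hz : ∀ i : K, w (Sum.inl i) = 0 := fun i => by simpa using hzero i i.2
      simp only [hz, zero_smul, Finset.sum_const_zero, zero_add] at hw
      have := Fintype.linearIndependent_iff.1 hb _ hw
      rcases s with i | j
      · exact hs (hz i)
      · exact hs (this j)
  obtain ⟨γ, δ, hsum, hpos⟩ : ∃ (γ : I → ℝ) (δ : J → ℝ),
      ∑ i ∈ K, γ i • a i + ∑ j, δ j • b j = 0 ∧ ∃ i ∈ K, 0 < γ i := by
    obtain ⟨γ, δ, hsum, i, hi, hne⟩ := hdep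
    rcases lt_or_gt_of_ne hne with h | h
    · refine ⟨-γ, -δ, ?_, i, hi, by simpa using h⟩
      simp only [Pi.neg_apply, neg_smul, Finset.sum_neg_distrib, ← neg_add, hsum, neg_zero]
    · exact ⟨γ, δ, hsum, i, hi, h⟩
  have hne : (K.filter fun i => 0 < γ i).Nonempty := by
    obtain ⟨i, hi, h⟩ := hpos
    exact ⟨i, Finset.mem_filter.2 ⟨hi, h⟩⟩
  obtain ⟨i₀, hi₀, hmin⟩ := Finset.exists_min_image _ (fun i => α i / γ i) hne
  rw [Finset.mem_filter] at hi₀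
  -- The largest step along the relation that keeps all coefficients nonnegative; it annihilates the
  -- one at `i₀`.
  set t := α i₀ / γ i₀ with ht
  have ht0 : 0 ≤ t := div_nonneg (hα _) hi₀.2.le
  have hzero : α i₀ - t * γ i₀ = 0 := by
    rw [ht, div_mul_cancel₀ _ hi₀.2.ne', sub_self]
  have hnn : ∀ i ∈ K, 0 ≤ α i - t * γ i := by
    intro i hi
    rcases le_or_gt (γ i) 0 with h | h
    · nlinarith [hα i]
    · have := hmin i (Finset.mem_filter.2 ⟨hi, h⟩)
      rw [le_div_iff₀ h] at this
      linarith
  obtain ⟨K', hK', α', β', h1, h2, h3⟩ := ih (K.erase i₀) (Finset.erase_ssubset hi₀.1)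
    -- The maximum changes nothing on `K`; it secures the sign off `K`, which the induction
    -- hypothesis also asks for.
    (fun i => max (α i - t * γ i) 0) (fun j => β j - t * δ j) (fun i => le_max_right _ _)
  refine ⟨K', hK'.trans (Finset.erase_subset _ _), α', β', h1, h2, h3.trans ?_⟩
  have h4 : ∑ i ∈ K.erase i₀, max (α i - t * γ i) 0 • a i = ∑ i ∈ K, (α i - t * γ i) • a i := by
    rw [← Finset.sum_erase K (a := i₀) (by rw [hzero, zero_smul])]
    exact Finset.sum_congr rfl fun i hi => by
      rw [max_eq_left (hnn i (Finset.mem_of_mem_erase hi))]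
  rw [h4]
  have h5 : ∑ i ∈ K, (α i - t * γ i) • a i + ∑ j, (β j - t * δ j) • b j =
      (∑ i ∈ K, α i • a i + ∑ j, β j • b j) -
        t • (∑ i ∈ K, γ i • a i + ∑ j, δ j • b j) := by
    simp only [sub_smul, mul_smul, Finset.sum_sub_distrib, smul_add, Finset.smul_sum]
    abel
  rw [h5, hsum, smul_zero, sub_zero]

/-- Under the constant rank and positive linear dependence conditions of RCPLD, multipliers can be
replaced by multipliers bounded linearly by the norm of the represented vector. -/
theorem exists_bounded_multipliers [FiniteDimensional ℝ V] {P : Type*} [TopologicalSpace P]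
    {p₀ : P} {Ω : Set P} (hp₀ : p₀ ∈ Ω) {a : I → P → V} {b : J → P → V}
    (ha : ∀ i, ContinuousAt (a i) p₀) (hb : ∀ j, ContinuousAt (b j) p₀)
    {U : Set P} (hU : U ∈ 𝓝 p₀) {act : Set I} {B : Finset J}
    (hB : LinearIndependent ℝ (fun j : B => b j p₀))
    (hspan : Submodule.span ℝ (Set.range fun j : B => b j p₀) =
      Submodule.span ℝ (Set.range fun j : J => b j p₀))
    {r : ℕ} (hr : ∀ p ∈ U, p ∈ Ω →
      Module.finrank ℝ (Submodule.span ℝ (Set.range fun j : J => b j p)) = r)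
    (hK : ∀ K : Finset I, (∀ i ∈ K, i ∈ act) →
      PosLinDep (fun i : K => a i p₀) (fun j : B => b j p₀) → ∀ p ∈ U, p ∈ Ω →
      ¬ LinearIndependent ℝ (Sum.elim (fun i : K => a i p) (fun j : B => b j p))) :
    ∃ M : ℝ, 0 ≤ M ∧ ∀ᶠ p in 𝓝 p₀, p ∈ Ω → ∀ (α : I → ℝ) (β : J → ℝ), (∀ i, 0 ≤ α i) →
      (∀ i, α i ≠ 0 → i ∈ act) → ∃ (α' : I → ℝ) (β' : J → ℝ), (∀ i, 0 ≤ α' i) ∧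
        (∀ i, α' i ≠ 0 → α i ≠ 0) ∧
        ∑ i, α' i • a i p + ∑ j, β' j • b j p = ∑ i, α i • a i p + ∑ j, β j • b j p ∧
        (∀ i, α' i ≤ M * ‖∑ i, α i • a i p + ∑ j, β j • b j p‖) ∧
        ∀ j, |β' j| ≤ M * ‖∑ i, α i • a i p + ∑ j, β j • b j p‖ := by
  classical
  -- There are finitely many `K`, so the sum of their constants serves all of them; dependent `K`
  -- receive the value 0.
  have hcoer : ∀ K : Finset I, ∃ M : ℝ, 0 ≤ M ∧
      (¬ PosLinDep (fun i : K => a i p₀) (fun j : B => b j p₀) →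
      ∀ᶠ p in 𝓝 p₀, ∀ (α : K → ℝ) (β : B → ℝ), (∀ i, 0 ≤ α i) →
        ‖(α, β)‖ ≤ M * ‖∑ i, α i • a i p + ∑ j, β j • b j p‖) := by
    intro K
    by_cases h : PosLinDep (fun i : K => a i p₀) (fun j : B => b j p₀)
    · exact ⟨0, le_rfl, fun h' => absurd h h'⟩
    · obtain ⟨c, hc, hev⟩ := eventually_coercive_of_not_posLinDep
        (a := fun i : K => a i) (b := fun j : B => b j) (fun i => ha i) (fun j => hb j) h
      refine ⟨c⁻¹, (inv_pos.2 hc).le, fun _ => hev.mono fun p hp α β hα => ?_⟩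
      rw [inv_mul_eq_div, le_div_iff₀ hc, mul_comm]
      exact hp α β hα
  choose M hM0 hM using hcoer
  refine ⟨∑ K, M K, Finset.sum_nonneg fun K _ => hM0 K, ?_⟩
  have hMle : ∀ K, M K ≤ ∑ K, M K := fun K =>
    Finset.single_le_sum (fun K _ => hM0 K) (Finset.mem_univ K)
  have hall : ∀ᶠ p in 𝓝 p₀, ∀ K : Finset I, ¬ PosLinDep (fun i : K => a i p₀) (fun j : B => b j p₀) →
      ∀ (α : K → ℝ) (β : B → ℝ), (∀ i, 0 ≤ α i) →
        ‖(α, β)‖ ≤ M K * ‖∑ i, α i • a i p + ∑ j, β j • b j p‖ := by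
    rw [eventually_all]
    intro K
    by_cases h : PosLinDep (fun i : K => a i p₀) (fun j : B => b j p₀)
    · exact Eventually.of_forall fun p h' => absurd h h'
    · exact (hM K h).mono fun p hp _ => hp
  have hLI : ∀ᶠ p in 𝓝 p₀, LinearIndependent ℝ (fun j : B => b j p) := by
    have hc : ContinuousAt (fun p => fun j : B => b j p) p₀ :=
      continuousAt_pi.2 fun j => hb j
    exact hc.eventually (isOpen_setOfPred_linearIndependent.mem_nhds hB)
  filter_upwards [hall, hLI, hU] with p hp hBp hpU hpΩ α β hα hact
  set w := ∑ i, α i • a i p + ∑ j, β j • b j p with hw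
  -- The vectors indexed by `B` stay independent near `p₀`, and constant rank equals their number,
  -- so they still span.
  have hspan_p : Submodule.span ℝ (Set.range fun j : B => b j p) =
      Submodule.span ℝ (Set.range fun j : J => b j p) := by
    refine Submodule.eq_of_le_of_finrank_eq (Submodule.span_mono ?_) ?_
    · rintro _ ⟨j, rfl⟩
      exact ⟨j, rfl⟩
    · rw [finrank_span_eq_card hBp, hr p hpU hpΩ, ← hr p₀ (mem_of_mem_nhds hU) hp₀, ← hspan,
        finrank_span_eq_card hB]
  obtain ⟨β₁, hβ₁⟩ : ∃ β₁ : B → ℝ, ∑ j, β₁ j • b j p = ∑ j, β j • b j p := by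
    rw [← Submodule.mem_span_range_iff_exists_fun, hspan_p]
    exact Submodule.sum_mem _ fun j _ =>
      Submodule.smul_mem _ _ (Submodule.subset_span ⟨j, rfl⟩)
  obtain ⟨K, hKs, α', β', hα', hind, hsum⟩ := exists_linearIndependent_combination
    (fun i => a i p) hBp (Finset.univ.filter fun i => α i ≠ 0) α β₁ hα
  have hsum' : ∑ i ∈ K, α' i • a i p + ∑ j, β' j • b j p = w := by
    rw [hsum, hβ₁, hw]
    congr 1
    refine Finset.sum_subset (Finset.subset_univ _) fun i _ hi => ?_
    have : α i = 0 := by simpa using hi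
    rw [this, zero_smul]
  have hKα : ∀ i ∈ K, α i ≠ 0 := fun i hi => (Finset.mem_filter.1 (hKs hi)).2
  -- Positive linear dependence at `p₀` would contradict the independence `hind` at `p`.
  have hnot : ¬ PosLinDep (fun i : K => a i p₀) (fun j : B => b j p₀) := fun h =>
    hK K (fun i hi => hact i (hKα i hi)) h p hpU hpΩ hind
  have hbd := hp K hnot (fun i => α' i) β' (fun i => hα' i)
  have hKsum : ∑ i : K, α' i • a i p = ∑ i ∈ K, α' i • a i p :=
    Finset.sum_coe_sort K fun i => α' i • a i p
  rw [hKsum, hsum'] at hbd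
  have hbd' := hbd.trans (mul_le_mul_of_nonneg_right (hMle K) (norm_nonneg w))
  have hw0 : 0 ≤ (∑ K, M K) * ‖w‖ := (norm_nonneg _).trans hbd'
  refine ⟨fun i => if i ∈ K then α' i else 0, fun j => if hj : j ∈ B then β' ⟨j, hj⟩ else 0,
    fun i => ?_, fun i hi => ?_, ?_, fun i => ?_, fun j => ?_⟩
  · dsimp only
    split_ifs
    exacts [hα' i, le_rfl]
  · by_cases hiK : i ∈ K
    · exact hKα i hiK
    · simp [hiK] at hi
  · rw [← hsum']
    congr 1
    · simp only [ite_smul, zero_smul, Finset.sum_ite_mem, Finset.univ_inter]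
    · rw [← Finset.sum_subset (Finset.subset_univ B), ← Finset.sum_coe_sort B]
      · simp
      · intro j _ hj
        simp [hj]
  · by_cases hiK : i ∈ K
    · simp only [hiK, if_true]
      exact ((le_abs_self _).trans (norm_le_pi_norm (fun i : K => α' i) ⟨i, hiK⟩)).trans
        ((norm_fst_le _).trans hbd')
    · simpa [hiK] using hw0
  · by_cases hj : j ∈ B
    · simp only [hj, dif_pos]
      exact (norm_le_pi_norm β' ⟨j, hj⟩).trans
        ((norm_snd_le ((fun i : K => α' i), β')).trans hbd')
    · simpa [hj] using hw0

end Multipliers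

/-! ### Karush-Kuhn-Tucker conditions for projections via quadratic penalties -/

section Penalty

theorem hasDerivAt_max_zero_sq (t : ℝ) :
    HasDerivAt (fun s : ℝ => max s 0 ^ 2) (2 * max t 0) t := by
  rcases lt_trichotomy t 0 with h | rfl | h
  · rw [max_eq_right h.le, mul_zero]
    refine (hasDerivAt_const t (0 : ℝ)).congr_of_eventuallyEq ?_
    filter_upwards [gt_mem_nhds h] with s hs
    simp [max_eq_right hs.le]
  · rw [max_self, mul_zero, hasDerivAt_iff_isLittleO]
    simp only [max_self, sub_zero, smul_zero, ne_eq, OfNat.ofNat_ne_zero, not_false_eq_true,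
      zero_pow]
    have h1 : (fun s : ℝ => max s 0 ^ 2) =O[𝓝 0] fun s => s ^ 2 := by
      refine Asymptotics.IsBigO.of_bound 1 (Eventually.of_forall fun s => ?_)
      rw [one_mul, norm_pow, norm_pow]
      gcongr
      rcases le_total s 0 with hs | hs
      · simp [max_eq_right hs]
      · rw [max_eq_left hs]
    exact h1.trans_isLittleO (Asymptotics.isLittleO_pow_id (by norm_num))
  · rw [max_eq_left h.le]
    have := (hasDerivAt_id t).fun_pow 2
    simp only [id, Nat.cast_ofNat, mul_one] at this
    refine (this.congr_deriv (by ring)).congr_of_eventuallyEq ?_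
    filter_upwards [lt_mem_nhds h] with s hs
    simp [max_eq_left hs.le]

variable {I J V : Type*} [Fintype I] [Fintype J] [NormedAddCommGroup V] [InnerProductSpace ℝ V]
  [FiniteDimensional ℝ V]

/-- Approximate Karush-Kuhn-Tucker conditions for the projection `y` of `p` onto
`{H i ≤ 0, G j = 0}`, which need no constraint qualification. -/
theorem exists_approx_kkt {H : I → V → ℝ} {a : I → V → V} {G : J → V → ℝ} {b : J → V → V}
    (hH : ∀ i z, HasGradientAt (H i) (a i z) z) (hG : ∀ j z, HasGradientAt (G j) (b j z) z)
    {p y : V} (hHy : ∀ i, H i y ≤ 0) (hGy : ∀ j, G j y = 0)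
    (hmin : ∀ z, (∀ i, H i z ≤ 0) → (∀ j, G j z = 0) → ‖p - y‖ ≤ ‖p - z‖)
    {δ : ℝ} (hδ : 0 < δ) :
    ∃ z, ‖z - y‖ < δ ∧ ∃ (α : I → ℝ) (β : J → ℝ), (∀ i, 0 ≤ α i) ∧
      (∀ i, α i ≠ 0 → 0 < H i z) ∧
      p - y = (2 : ℝ) • (z - y) + (∑ i, α i • a i z + ∑ j, β j • b j z) := by
  have hHc : ∀ i, Continuous (H i) := fun i =>
    continuous_iff_continuousAt.2 fun z => (hH i z).continuousAt
  have hGc : ∀ j, Continuous (G j) := fun j =>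
    continuous_iff_continuousAt.2 fun z => (hG j z).continuousAt
  set Q : V → ℝ := fun z => ∑ i, max (H i z) 0 ^ 2 + ∑ j, G j z ^ 2 with hQ
  have hQ0 : ∀ z, 0 ≤ Q z := fun z => by positivity
  have hQc : Continuous Q := by fun_prop
  have hQy : Q y = 0 := by simp [hQ, hGy, hHy]
  -- The extra term `‖z - y‖ ^ 2` singles out `y` among all nearest points, so the penalty
  -- minimizers have a subsequence converging to `y`.
  set R : V → ℝ := fun z => ‖z - p‖ ^ 2 + ‖z - y‖ ^ 2 with hR
  have hRc : Continuous R := by fun_prop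
  have hex : ∀ c : ℕ, ∃ z ∈ Metric.closedBall y 1,
      ∀ w ∈ Metric.closedBall y 1, R z + c * Q z ≤ R w + c * Q w := fun c =>
    (isCompact_closedBall y 1).exists_isMinOn ⟨y, Metric.mem_closedBall_self zero_le_one⟩
      (by fun_prop : Continuous fun z => R z + c * Q z).continuousOn
  choose z hzmem hzmin using hex
  obtain ⟨z₀, hz₀, s, hs, hlim⟩ := (isCompact_closedBall y 1).tendsto_subseq hzmem
  have hbd : ∀ c, R (z c) + c * Q (z c) ≤ R y := fun c => by
    simpa [hQy] using hzmin c y (Metric.mem_closedBall_self zero_le_one)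
  have hRlim : R z₀ ≤ R y := by
    refine le_of_tendsto ((hRc.tendsto z₀).comp hlim) (Eventually.of_forall fun k => ?_)
    have := hbd (s k)
    have h2 : 0 ≤ (s k : ℝ) * Q (z (s k)) := mul_nonneg (Nat.cast_nonneg _) (hQ0 _)
    simp only [Function.comp_apply]
    linarith
  have hQlim : Q z₀ = 0 := by
    refine le_antisymm ?_ (hQ0 _)
    have h1 : Tendsto (fun k => R y / (s k : ℝ)) atTop (𝓝 0) :=
      tendsto_const_nhds.div_atTop (tendsto_natCast_atTop_atTop.comp hs.tendsto_atTop)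
    refine le_of_tendsto_of_tendsto ((hQc.tendsto z₀).comp hlim) h1 ?_
    filter_upwards [eventually_gt_atTop 0] with k hk
    have hpos : (0 : ℝ) < s k := Nat.cast_pos.2 (lt_of_lt_of_le hk (hs.le_apply))
    rw [le_div_iff₀ hpos]
    have := hbd (s k)
    have h2 : 0 ≤ R (z (s k)) := by positivity
    simp only [Function.comp_apply]
    linarith
  have hz₀y : z₀ = y := by
    have h1 : ∑ i, max (H i z₀) 0 ^ 2 = 0 ∧ ∑ j, G j z₀ ^ 2 = 0 :=
      (add_eq_zero_iff_of_nonneg (by positivity) (by positivity)).1 hQlim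
    rw [Finset.sum_eq_zero_iff_of_nonneg (fun _ _ => by positivity),
      Finset.sum_eq_zero_iff_of_nonneg (fun _ _ => by positivity)] at h1
    have h2 := hmin z₀ (fun i => by simpa using h1.1 i (Finset.mem_univ _))
      (fun j => by simpa using h1.2 j (Finset.mem_univ _))
    have h3 : R y = ‖y - p‖ ^ 2 := by simp [hR]
    rw [h3, hR] at hRlim
    rw [norm_sub_rev p y, norm_sub_rev p z₀] at h2
    have h4 : ‖y - p‖ ^ 2 ≤ ‖z₀ - p‖ ^ 2 := by gcongr
    have h5 : ‖z₀ - y‖ ^ 2 ≤ 0 := by simp only at hRlim; linarith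
    have h6 : ‖z₀ - y‖ = 0 := by nlinarith [norm_nonneg (z₀ - y)]
    exact sub_eq_zero.1 (norm_eq_zero.1 h6)
  rw [hz₀y] at hlim
  obtain ⟨k, hk⟩ := (hlim.eventually (Metric.ball_mem_nhds y (lt_min hδ one_pos))).exists
  set c := s k
  have hzk : ‖z c - y‖ < min δ 1 := by rw [← dist_eq_norm]; exact hk
  -- The minimizer lies inside the unit ball, so the restriction to the ball is inactive.
  have hloc : IsLocalMin (fun w => R w + c * Q w) (z c) := by
    refine Filter.mem_of_superset (Metric.isOpen_ball.mem_nhds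
      (show z c ∈ Metric.ball y 1 from ?_)) fun w hw => hzmin c w (Metric.ball_subset_closedBall hw)
    rw [Metric.mem_ball, dist_eq_norm]
    exact hzk.trans_le (min_le_right _ _)
  refine ⟨z c, hzk.trans_le (min_le_left _ _), fun i => c * max (H i (z c)) 0,
    fun j => c * G j (z c), fun i => by positivity, fun i hi => ?_, ?_⟩
  · by_contra! hle
    exact hi (mul_eq_zero_of_right _ (max_eq_right hle))
  have hdR : HasFDerivAt R (2 • innerSL ℝ (z c - p) + 2 • innerSL ℝ (z c - y)) (z c) := by
    have h1 := ((hasFDerivAt_id (𝕜 := ℝ) (z c)).sub_const p).norm_sq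
    have h2 := ((hasFDerivAt_id (𝕜 := ℝ) (z c)).sub_const y).norm_sq
    exact h1.add h2
  have hdQ : HasFDerivAt Q (∑ i, (2 * max (H i (z c)) 0) • innerSL ℝ (a i (z c)) +
      ∑ j, (2 * G j (z c)) • innerSL ℝ (b j (z c))) (z c) := by
    refine HasFDerivAt.add (HasFDerivAt.fun_sum fun i _ => ?_) (HasFDerivAt.fun_sum fun j _ => ?_)
    · exact (hasDerivAt_max_zero_sq (H i (z c))).comp_hasFDerivAt (z c)
        (hH i (z c)).hasFDerivAt
    · have h1 := (hasDerivAt_pow 2 (G j (z c))).comp_hasFDerivAt (z c) (hG j (z c)).hasFDerivAt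
      exact h1.congr_fderiv (by ext u; simp)
  have hzero := hloc.hasFDerivAt_eq_zero (hdR.add (hdQ.const_mul (c : ℝ)))
  -- Half the gradient of the penalized objective; testing the vanishing derivative on `v` itself
  -- gives `v = 0`.
  set v := (z c - p) + (z c - y) +
    (∑ i, (c * max (H i (z c)) 0) • a i (z c) + ∑ j, (c * G j (z c)) • b j (z c)) with hv
  have hv0 : v = 0 := by
    rw [← inner_self_eq_zero (𝕜 := ℝ)]
    have h1 := congrArg (fun L => L v) hzero
    simp only [_root_.add_apply, _root_.smul_apply,
      _root_.sum_apply, innerSL_apply_apply, _root_.zero_apply,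
      smul_eq_mul, nsmul_eq_mul, Nat.cast_ofNat] at h1
    have h2 : ∀ u, inner ℝ v u = inner ℝ (z c - p) u + inner ℝ (z c - y) u +
        (∑ i, (c * max (H i (z c)) 0) * inner ℝ (a i (z c)) u +
          ∑ j, (c * G j (z c)) * inner ℝ (b j (z c)) u) := fun u => by
      simp only [hv, inner_add_left, sum_inner, real_inner_smul_left]
    rw [h2 v]
    simp only [mul_add, Finset.mul_sum] at h1
    simp only [mul_assoc, mul_left_comm (c : ℝ) 2, ← Finset.mul_sum] at h1 ⊢
    linarith
  rw [← add_zero (p - y), ← hv0, hv, two_smul]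
  abel

/-- Karush-Kuhn-Tucker conditions for the projection `y` of `p` onto `{H i ≤ 0, G j = 0}` when
multipliers near `y` can be chosen bounded. -/
theorem exists_kkt_of_bounded_multipliers {H : I → V → ℝ} {a : I → V → V} {G : J → V → ℝ}
    {b : J → V → V}
    (hH : ∀ i z, HasGradientAt (H i) (a i z) z) (hG : ∀ j z, HasGradientAt (G j) (b j z) z)
    (ha : ∀ i, Continuous (a i)) (hb : ∀ j, Continuous (b j))
    {p y : V} (hHy : ∀ i, H i y ≤ 0) (hGy : ∀ j, G j y = 0)
    (hmin : ∀ z, (∀ i, H i z ≤ 0) → (∀ j, G j z = 0) → ‖p - y‖ ≤ ‖p - z‖)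
    {M : ℝ} (hM0 : 0 ≤ M)
    (hM : ∀ᶠ z in 𝓝 y, ∀ (α : I → ℝ) (β : J → ℝ), (∀ i, 0 ≤ α i) →
      (∀ i, α i ≠ 0 → 0 < H i z) → ∃ (α' : I → ℝ) (β' : J → ℝ), (∀ i, 0 ≤ α' i) ∧
        (∀ i, α' i ≠ 0 → α i ≠ 0) ∧
        ∑ i, α' i • a i z + ∑ j, β' j • b j z = ∑ i, α i • a i z + ∑ j, β j • b j z ∧
        (∀ i, α' i ≤ M * ‖∑ i, α i • a i z + ∑ j, β j • b j z‖) ∧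
        ∀ j, |β' j| ≤ M * ‖∑ i, α i • a i z + ∑ j, β j • b j z‖) :
    ∃ (α : I → ℝ) (β : J → ℝ), (∀ i, 0 ≤ α i) ∧ (∀ i, α i ≠ 0 → H i y = 0) ∧
      p - y = ∑ i, α i • a i y + ∑ j, β j • b j y ∧
      (∀ i, α i ≤ M * ‖p - y‖) ∧ ∀ j, |β j| ≤ M * ‖p - y‖ := by
  obtain ⟨ε, hε, hball⟩ := Metric.eventually_nhds_iff_ball.1 hM
  have hstep : ∀ k : ℕ, ∃ (z : V) (α : I → ℝ) (β : J → ℝ), ‖z - y‖ < 1 / ((k : ℝ) + 1) ∧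
      (∀ i, 0 ≤ α i) ∧ (∀ i, α i ≠ 0 → 0 < H i z) ∧
      p - y = (2 : ℝ) • (z - y) + (∑ i, α i • a i z + ∑ j, β j • b j z) ∧
      (∀ i, α i ≤ M * ‖(p - y) - (2 : ℝ) • (z - y)‖) ∧
      ∀ j, |β j| ≤ M * ‖(p - y) - (2 : ℝ) • (z - y)‖ := by
    intro k
    have hk : 0 < 1 / ((k : ℝ) + 1) := by positivity
    obtain ⟨z, hz, α, β, hα, hsupp, heq⟩ :=
      exists_approx_kkt hH hG hHy hGy hmin (lt_min hk hε)
    have hzb : z ∈ Metric.ball y ε := by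
      rw [Metric.mem_ball, dist_eq_norm]
      exact hz.trans_le (min_le_right _ _)
    obtain ⟨α', β', hα', hsupp', heq', hb1, hb2⟩ := hball z hzb α β hα hsupp
    have hw : (p - y) - (2 : ℝ) • (z - y) = ∑ i, α i • a i z + ∑ j, β j • b j z := by
      rw [heq]; abel
    rw [← hw] at hb1 hb2
    exact ⟨z, α', β', hz.trans_le (min_le_left _ _), hα', fun i hi => hsupp i (hsupp' i hi),
      by rw [heq', ← heq], hb1, hb2⟩
  choose z α β hz hα hsupp heq hb1 hb2 using hstep
  have hzlim : Tendsto z atTop (𝓝 y) := by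
    rw [tendsto_iff_norm_sub_tendsto_zero]
    exact squeeze_zero (fun _ => norm_nonneg _) (fun k => (hz k).le)
      tendsto_one_div_add_atTop_nhds_zero_nat
  -- A crude bound using `‖z k - y‖ ≤ 1`, needed only for compactness; the sharp bound `M * ‖p - y‖`
  -- is recovered in the limit.
  set N : ℝ := M * (‖p - y‖ + 2) with hN
  have hle : ∀ k, M * ‖(p - y) - (2 : ℝ) • (z k - y)‖ ≤ N := fun k => by
    refine mul_le_mul_of_nonneg_left ((norm_sub_le _ _).trans ?_) hM0
    have h1 : ‖z k - y‖ ≤ 1 := (hz k).le.trans <| by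
      rw [div_le_one (by positivity)]
      linarith [(Nat.cast_nonneg k : (0 : ℝ) ≤ k)]
    rw [norm_smul, Real.norm_ofNat]
    linarith
  have hmem : ∀ k, (α k, β k) ∈ (Set.Icc (fun _ => -N) (fun _ => N) ×ˢ
      Set.Icc (fun _ => -N) (fun _ => N) : Set ((I → ℝ) × (J → ℝ))) := by
    intro k
    have hN0 : 0 ≤ N := by positivity
    refine ⟨⟨fun i => ?_, fun i => (hb1 k i).trans (hle k)⟩, fun j => ?_, fun j => ?_⟩
    · exact (neg_nonpos.2 hN0).trans (hα k i)
    · exact (abs_le.1 ((hb2 k j).trans (hle k))).1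
    · exact (abs_le.1 ((hb2 k j).trans (hle k))).2
  obtain ⟨⟨α₀, β₀⟩, -, s, hs, hlim⟩ := (isCompact_Icc.prod isCompact_Icc).tendsto_subseq hmem
  have hαl : ∀ i, Tendsto (fun k => α (s k) i) atTop (𝓝 (α₀ i)) := fun i =>
    (tendsto_pi_nhds.1 ((continuous_fst.tendsto _).comp hlim)) i
  have hβl : ∀ j, Tendsto (fun k => β (s k) j) atTop (𝓝 (β₀ j)) := fun j =>
    (tendsto_pi_nhds.1 ((continuous_snd.tendsto _).comp hlim)) j
  have hzs : Tendsto (fun k => z (s k)) atTop (𝓝 y) := hzlim.comp hs.tendsto_atTop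
  have hnl : Tendsto (fun k => M * ‖(p - y) - (2 : ℝ) • (z (s k) - y)‖) atTop
      (𝓝 (M * ‖p - y‖)) := by
    have hc : Continuous fun w => M * ‖(p - y) - (2 : ℝ) • (w - y)‖ := by fun_prop
    simpa [Function.comp_def] using (hc.tendsto y).comp hzs
  refine ⟨α₀, β₀, fun i => ge_of_tendsto' (hαl i) fun k => hα _ i, fun i hi => ?_, ?_,
    fun i => le_of_tendsto_of_tendsto' (hαl i) hnl fun k => hb1 _ i,
    fun j => le_of_tendsto_of_tendsto' (hβl j).abs hnl fun k => hb2 _ j⟩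
  -- Where the limit multiplier is nonzero, `H i` is eventually positive along the subsequence,
  -- hence nonnegative at `y`.
  · refine le_antisymm (hHy i) ?_
    refine ge_of_tendsto (((hH i y).continuousAt.tendsto).comp hzs) ?_
    filter_upwards [(hαl i).eventually_ne hi] with k hk
    exact (hsupp _ i hk).le
  · have hconst : Tendsto (fun _ : ℕ => p - y) atTop (𝓝 (p - y)) := tendsto_const_nhds
    refine tendsto_nhds_unique hconst ?_
    have h1 : Tendsto (fun k => (2 : ℝ) • (z (s k) - y) + (∑ i, α (s k) i • a i (z (s k)) +
        ∑ j, β (s k) j • b j (z (s k)))) atTop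
        (𝓝 ((2 : ℝ) • (y - y) + (∑ i, α₀ i • a i y + ∑ j, β₀ j • b j y))) := by
      refine ((hzs.sub_const y).const_smul 2).add
        ((tendsto_finsetSum _ fun i _ => (hαl i).smul ?_).add
          (tendsto_finsetSum _ fun j _ => (hβl j).smul ?_))
      · exact ((ha i).tendsto y).comp hzs
      · exact ((hb j).tendsto y).comp hzs
    rw [sub_self, smul_zero, zero_add] at h1
    exact h1.congr fun k => (heq (s k)).symm

end Penalty

/-! ### Partial gradients and first-order estimates -/

section Gradients

variable {n m : ℕ} {φ : Vec n → Vec m → ℝ}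

theorem hasFDerivAt_right (hφ : ContDiff ℝ 1 fun z : Vec n × Vec m => φ z.1 z.2)
    (x : Vec n) (y : Vec m) :
    HasFDerivAt (φ x) ((fderiv ℝ (fun z : Vec n × Vec m => φ z.1 z.2) (x, y)).comp
      (ContinuousLinearMap.inr ℝ (Vec n) (Vec m))) y :=
  HasFDerivAt.comp (f := fun y => (x, y)) y (hφ.differentiable one_ne_zero (x, y)).hasFDerivAt
    (hasFDerivAt_prodMk_right x y)

theorem hasGradientAt_right (hφ : ContDiff ℝ 1 fun z : Vec n × Vec m => φ z.1 z.2)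
    (x : Vec n) (y : Vec m) : HasGradientAt (φ x) (gradient (φ x) y) y :=
  (hasFDerivAt_right hφ x y).differentiableAt.hasGradientAt

theorem continuous_gradient_right (hφ : ContDiff ℝ 1 fun z : Vec n × Vec m => φ z.1 z.2) :
    Continuous fun z : Vec n × Vec m => gradient (φ z.1) z.2 := by
  have h1 : ∀ z : Vec n × Vec m, gradient (φ z.1) z.2 = (InnerProductSpace.toDual ℝ (Vec m)).symm
      ((fderiv ℝ (fun z : Vec n × Vec m => φ z.1 z.2) z).comp
        (ContinuousLinearMap.inr ℝ (Vec n) (Vec m))) := fun z => by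
    rw [gradient, (hasFDerivAt_right hφ z.1 z.2).fderiv]
  simp only [h1]
  exact (LinearIsometryEquiv.continuous _).comp
    ((hφ.continuous_fderiv one_ne_zero).clm_comp continuous_const)

/-- Strict differentiability at `(x₀, y₀)`, used for two points with the same `x`, and continuity of
the gradient contribute `ε / 2` each. This makes the estimate uniform in `x` and in the base point.
-/
theorem eventually_abs_sub_inner_gradient_le
    (hφ : ContDiff ℝ 1 fun z : Vec n × Vec m => φ z.1 z.2) (x₀ : Vec n) (y₀ : Vec m)
    {ε : ℝ} (hε : 0 < ε) :
    ∀ᶠ w : Vec n × Vec m × Vec m in 𝓝 (x₀, y₀, y₀),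
      |φ w.1 w.2.2 - φ w.1 w.2.1 - inner ℝ (gradient (φ w.1) w.2.1) (w.2.2 - w.2.1)| ≤
        ε * ‖w.2.2 - w.2.1‖ := by
  have hs := (hφ.contDiffAt (x := (x₀, y₀))).hasStrictFDerivAt one_ne_zero
  have h1 := hs.isLittleO.bound (half_pos hε)
  have hc1 : Tendsto (fun w : Vec n × Vec m × Vec m => ((w.1, w.2.2), (w.1, w.2.1)))
      (𝓝 (x₀, y₀, y₀)) (𝓝 ((x₀, y₀), (x₀, y₀))) := by
    have : Continuous fun w : Vec n × Vec m × Vec m => ((w.1, w.2.2), (w.1, w.2.1)) := by fun_prop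
    exact this.tendsto _
  have hc2 : Tendsto (fun w : Vec n × Vec m × Vec m => (w.1, w.2.1))
      (𝓝 (x₀, y₀, y₀)) (𝓝 (x₀, y₀)) := by
    have : Continuous fun w : Vec n × Vec m × Vec m => (w.1, w.2.1) := by fun_prop
    exact this.tendsto _
  have h2 := ((continuous_gradient_right hφ).tendsto (x₀, y₀)).eventually
    (Metric.ball_mem_nhds _ (half_pos hε))
  filter_upwards [hc1.eventually h1, hc2.eventually h2] with w hw1 hw2
  rw [dist_eq_norm] at hw2
  have h3 : fderiv ℝ (fun z : Vec n × Vec m => φ z.1 z.2) (x₀, y₀)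
      ((w.1, w.2.2) - (w.1, w.2.1)) = inner ℝ (gradient (φ x₀) y₀) (w.2.2 - w.2.1) := by
    rw [inner_gradient_left, (hasFDerivAt_right hφ x₀ y₀).fderiv]
    simp
  rw [h3, Real.norm_eq_abs, Prod.mk_sub_mk, sub_self, Prod.norm_mk, norm_zero,
    max_eq_right (norm_nonneg _)] at hw1
  have h4 := abs_real_inner_le_norm (gradient (φ w.1) w.2.1 - gradient (φ x₀) y₀) (w.2.2 - w.2.1)
  rw [inner_sub_left] at h4
  have h5 := mul_le_mul_of_nonneg_right hw2.le (norm_nonneg (w.2.2 - w.2.1))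
  rw [abs_le] at *
  constructor <;> linarith [hw1.1, hw1.2, h4.1, h4.2]

theorem inner_gradient_le_of_convexOn {V : Type*} [NormedAddCommGroup V] [InnerProductSpace ℝ V]
    [CompleteSpace V] {ψ : V → ℝ} (hψ : ConvexOn ℝ Set.univ ψ) {d y : V}
    (hd : HasGradientAt ψ d y) (p : V) : inner ℝ d (p - y) ≤ ψ p - ψ y := by
  have hconv : ConvexOn ℝ Set.univ (ψ ∘ AffineMap.lineMap (k := ℝ) y p) :=
    hψ.comp_affineMap (AffineMap.lineMap y p)
  have hline : HasDerivAt (AffineMap.lineMap (k := ℝ) y p) (p - y) 0 :=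
    AffineMap.hasDerivAt_lineMap
  have hder : HasDerivAt (ψ ∘ AffineMap.lineMap (k := ℝ) y p) (inner ℝ d (p - y)) 0 := by
    refine HasFDerivAt.comp_hasDerivAt (l' := InnerProductSpace.toDual ℝ V d) 0 ?_ hline
    rw [AffineMap.lineMap_apply_zero]
    exact hd.hasFDerivAt
  have h1 := hconv.le_slope_of_hasDerivAt (Set.mem_univ 0) (Set.mem_univ 1) one_pos hder
  simpa [slope_def_field] using h1

theorem inner_gradient_eq_of_affine {V : Type*} [NormedAddCommGroup V] [InnerProductSpace ℝ V]
    [CompleteSpace V] {ψ : V → ℝ} {A : V →ᵃ[ℝ] ℝ} (hA : ∀ y, ψ y = A y) {d y : V}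
    (hd : HasGradientAt ψ d y) (p : V) : inner ℝ d (p - y) = ψ p - ψ y := by
  obtain rfl : ψ = A := funext hA
  have hline : HasDerivAt (AffineMap.lineMap (k := ℝ) y p) (p - y) 0 :=
    AffineMap.hasDerivAt_lineMap
  have hder : HasDerivAt (A ∘ AffineMap.lineMap (k := ℝ) y p) (inner ℝ d (p - y)) 0 := by
    refine HasFDerivAt.comp_hasDerivAt (l' := InnerProductSpace.toDual ℝ V d) 0 ?_ hline
    rw [AffineMap.lineMap_apply_zero]
    exact hd.hasFDerivAt
  have h2 : A ∘ AffineMap.lineMap (k := ℝ) y p = AffineMap.lineMap (A y) (A p) := by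
    ext t
    simp [AffineMap.apply_lineMap]
  rw [h2] at hder
  exact hder.unique AffineMap.hasDerivAt_lineMap

end Gradients

/-! ### Projections onto the solution set and error estimates -/

section Solution

variable {n m l q : ℕ} {f : Vec n → Vec m → ℝ}
  {h : Fin l → Vec n → Vec m → ℝ} {g : Fin q → Vec n → Vec m → ℝ}

theorem valueFun_eq_of_mem_solMap {x : Vec n} {y : Vec m} (hy : y ∈ solMap f h g x) :
    valueFun f h g x = (f x y : EReal) :=
  le_antisymm (iInf₂_le y hy.1)
    (le_iInf₂ fun z hz => EReal.coe_le_coe_iff.2 (hy.2 z hz))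

theorem sub_valueFun_le_iff {x : Vec n} {y p : Vec m} (hy : y ∈ solMap f h g x) (u : ℝ) :
    (f x p : EReal) - valueFun f h g x ≤ (u : EReal) ↔ f x p - f x y ≤ u := by
  rw [valueFun_eq_of_mem_solMap hy, ← EReal.coe_sub, EReal.coe_le_coe_iff]

theorem isClosed_feasMap (hh : ∀ i, ContDiff ℝ 1 fun z : Vec n × Vec m => h i z.1 z.2)
    (hg : ∀ j, ContDiff ℝ 1 fun z : Vec n × Vec m => g j z.1 z.2) :
    IsClosed {z : Vec n × Vec m | z.2 ∈ feasMap h g z.1} := by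
  have h1 : {z : Vec n × Vec m | z.2 ∈ feasMap h g z.1} =
      (⋂ i, {z | h i z.1 z.2 ≤ 0}) ∩ ⋂ j, {z | g j z.1 z.2 = 0} := by
    ext z; simp [feasMap]
  rw [h1]
  exact (isClosed_iInter fun i => isClosed_le (hh i).continuous continuous_const).inter
    (isClosed_iInter fun j => isClosed_eq (hg j).continuous continuous_const)

theorem isClosed_feasMap_apply (hh : ∀ i, ContDiff ℝ 1 fun z : Vec n × Vec m => h i z.1 z.2)
    (hg : ∀ j, ContDiff ℝ 1 fun z : Vec n × Vec m => g j z.1 z.2) (x : Vec n) :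
    IsClosed (feasMap h g x) :=
  (isClosed_feasMap hh hg).preimage (Continuous.prodMk_right x)

theorem isClosed_solMap (hf : ContDiff ℝ 1 fun z : Vec n × Vec m => f z.1 z.2)
    (hh : ∀ i, ContDiff ℝ 1 fun z : Vec n × Vec m => h i z.1 z.2)
    (hg : ∀ j, ContDiff ℝ 1 fun z : Vec n × Vec m => g j z.1 z.2) (x : Vec n) :
    IsClosed (solMap f h g x) := by
  have hfx : Continuous (f x) := hf.continuous.comp (Continuous.prodMk_right x)
  have h1 : solMap f h g x = feasMap h g x ∩ ⋂ y' ∈ feasMap h g x, {y | f x y ≤ f x y'} := by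
    ext y; simp [solMap]
  rw [h1]
  exact (isClosed_feasMap_apply hh hg x).inter
    (isClosed_biInter fun _ _ => isClosed_le hfx continuous_const)

theorem exists_projection_solMap (hf : ContDiff ℝ 1 fun z : Vec n × Vec m => f z.1 z.2)
    (hh : ∀ i, ContDiff ℝ 1 fun z : Vec n × Vec m => h i z.1 z.2)
    (hg : ∀ j, ContDiff ℝ 1 fun z : Vec n × Vec m => g j z.1 z.2) {x : Vec n}
    (hne : (solMap f h g x).Nonempty) (p : Vec m) :
    ∃ y ∈ solMap f h g x, ∀ z ∈ solMap f h g x, ‖p - y‖ ≤ ‖p - z‖ := by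
  obtain ⟨y, hy, hd⟩ := (isClosed_solMap hf hh hg x).exists_infDist_eq_dist hne p
  refine ⟨y, hy, fun z hz => ?_⟩
  rw [← dist_eq_norm, ← dist_eq_norm, ← hd]
  exact Metric.infDist_le_dist_of_mem hz

theorem solMap_nonempty_of_isBounded (hf : ContDiff ℝ 1 fun z : Vec n × Vec m => f z.1 z.2)
    (hh : ∀ i, ContDiff ℝ 1 fun z : Vec n × Vec m => h i z.1 z.2)
    (hg : ∀ j, ContDiff ℝ 1 fun z : Vec n × Vec m => g j z.1 z.2) {x : Vec n}
    (hne : (feasMap h g x).Nonempty) (hbd : Bornology.IsBounded (feasMap h g x)) :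
    (solMap f h g x).Nonempty := by
  have hfx : Continuous (f x) := hf.continuous.comp (Continuous.prodMk_right x)
  obtain ⟨y, hy, hmin⟩ := (Metric.isCompact_of_isClosed_isBounded
    (isClosed_feasMap_apply hh hg x) hbd).exists_isMinOn hne hfx.continuousOn
  exact ⟨y, hy, fun z hz => hmin hz⟩

variable (f h) in
/-- The partial gradients in `y` of the inequality constraints `f - φ` and `h i` of `S`. -/
def ineqGrad : Option (Fin l) → Vec n × Vec m → Vec m
  | none, w => gradient (f w.1) w.2
  | some i, w => gradient (h i w.1) w.2

/-- A solution certifies that `φ x` is real, hence a constant that differentiation in `y` discards.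
-/
theorem gradY_solIneq {x : Vec n} (hx : (solMap f h g x).Nonempty) (i : Option (Fin l))
    (y : Vec m) : gradY (solIneq f h g i) x y = ineqGrad f h i (x, y) := by
  cases i with
  | some i => simp [gradY, solIneq, ineqGrad]
  | none =>
    obtain ⟨z, hz⟩ := hx
    have h1 : (fun y' => (solIneq f h g none x y').toReal) = fun y' => f x y' - f x z := by
      ext y'
      rw [solIneq, valueFun_eq_of_mem_solMap hz, ← EReal.coe_sub, EReal.toReal_coe]
    rw [gradY, h1, gradient, fderiv_sub_const]
    rfl

/-- Near a point of `gph S` where RCPLD holds, projections onto `S` satisfy Karush-Kuhn-Tucker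
conditions with multipliers bounded by a multiple of the distance. -/
theorem RCPLDSol.exists_local_kkt (hf : ContDiff ℝ 1 fun z : Vec n × Vec m => f z.1 z.2)
    (hh : ∀ i, ContDiff ℝ 1 fun z : Vec n × Vec m => h i z.1 z.2)
    (hg : ∀ j, ContDiff ℝ 1 fun z : Vec n × Vec m => g j z.1 z.2) {x₀ : Vec n} {y₀ : Vec m}
    (hy₀ : y₀ ∈ solMap f h g x₀) (hR : RCPLDSol f h g (dom (feasMap h g)) x₀ y₀) :
    ∃ M : ℝ, 0 ≤ M ∧ ∀ᶠ w : Vec n × Vec m in 𝓝 (x₀, y₀), w.2 ∈ solMap f h g w.1 →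
      ∀ p, (∀ z ∈ solMap f h g w.1, ‖p - w.2‖ ≤ ‖p - z‖) →
      ∃ (α : Option (Fin l) → ℝ) (β : Fin q → ℝ), (∀ i, 0 ≤ α i) ∧
        (∀ i, α (some i) ≠ 0 → h i w.1 w.2 = 0) ∧
        p - w.2 = ∑ i, α i • ineqGrad f h i w + ∑ j, β j • gradient (g j w.1) w.2 ∧
        (∀ i, α i ≤ M * ‖p - w.2‖) ∧ ∀ j, |β j| ≤ M * ‖p - w.2‖ := by
  obtain ⟨U, hU, B, ⟨hB, hspan⟩, ⟨r, hr⟩, hK⟩ := hR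
  have hgy : ∀ j x y, gradY (fun x y => (g j x y : EReal)) x y = gradient (g j x) y := fun j x y => by
    simp [gradY]
  simp only [hgy] at hB hspan hr hK
  have hac : ∀ i, Continuous (ineqGrad f h i) := by
    rintro (_ | i)
    exacts [continuous_gradient_right hf, continuous_gradient_right (hh i)]
  have hbc : ∀ j, Continuous fun w : Vec n × Vec m => gradient (g j w.1) w.2 := fun j =>
    continuous_gradient_right (hg j)
  have hdom : ∀ x, (solMap f h g x).Nonempty → x ∈ dom (feasMap h g) :=
    fun x ⟨y, hy⟩ => ⟨y, hy.1⟩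
  obtain ⟨M, hM0, hM⟩ := exists_bounded_multipliers (p₀ := (x₀, y₀))
    -- `Ω` is restricted to points where `S` is nonempty, so that the gradient of `f - φ` is that of
    -- `f`.
    (Ω := {w | (solMap f h g w.1).Nonempty}) (act := {i | solIneq f h g i x₀ y₀ = 0}) (U := U)
    (a := ineqGrad f h) (b := fun j w => gradient (g j w.1) w.2) ⟨y₀, hy₀⟩
    (fun i => (hac i).continuousAt) (fun j => (hbc j).continuousAt) hU hB hspan
    (fun w hw hwΩ => hr w.1 w.2 hw (hdom _ hwΩ))
    (fun K hKact hdep w hw hwΩ => by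
      have h1 := hK K hKact
      simp only [gradY_solIneq ⟨y₀, hy₀⟩] at h1
      have h2 := h1 hdep w.1 w.2 hw (hdom _ hwΩ)
      simpa only [gradY_solIneq hwΩ] using h2)
  have hinact : ∀ᶠ w : Vec n × Vec m in 𝓝 (x₀, y₀), ∀ i, h i x₀ y₀ ≠ 0 → h i w.1 w.2 < 0 := by
    rw [eventually_all]
    intro i
    by_cases h0 : h i x₀ y₀ = 0
    · exact Eventually.of_forall fun w hw => absurd h0 hw
    · have hlt : h i x₀ y₀ < 0 := lt_of_le_of_ne (hy₀.1.1 i) h0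
      exact (((hh i).continuous.tendsto (x₀, y₀)).eventually (gt_mem_nhds hlt)).mono
        fun w hw _ => hw
  refine ⟨M, hM0, ?_⟩
  -- The multiplier bound is needed on a whole neighborhood of each `w`, since the approximate KKT
  -- points only lie near the projection.
  filter_upwards [eventually_eventually_nhds.2 (hM.and hinact)] with ⟨x, y⟩ hw hy p hp
  have hslice : ∀ᶠ z in 𝓝 y, _ := ((Continuous.prodMk_right x).tendsto y).eventually hw
  -- With `x` fixed, `φ x` equals the real number `f x y`.
  set H : Option (Fin l) → Vec m → ℝ := fun i z => i.elim (f x z - f x y) fun i => h i x z with hH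
  have hHg : ∀ i z, HasGradientAt (H i) (ineqGrad f h i (x, z)) z := by
    rintro (_ | i) z
    · exact HasFDerivAt.sub_const (f x y) (hasGradientAt_right hf x z).hasFDerivAt
    · exact hasGradientAt_right (hh i) x z
  have hsol : ∀ z, (∀ i, H i z ≤ 0) → (∀ j, g j x z = 0) → z ∈ solMap f h g x := fun z h1 h2 =>
    ⟨⟨fun i => h1 (some i), h2⟩, fun y' hy' => (sub_nonpos.1 (h1 none)).trans (hy.2 y' hy')⟩
  obtain ⟨α, β, h1, h2, h3, h4, h5⟩ := exists_kkt_of_bounded_multipliers (H := H)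
    (a := fun i z => ineqGrad f h i (x, z)) (G := fun j => g j x)
    (b := fun j => gradient (g j x)) hHg (fun j => hasGradientAt_right (hg j) x)
    (fun i => (hac i).comp (Continuous.prodMk_right x))
    (fun j => (hbc j).comp (Continuous.prodMk_right x)) (p := p) (y := y)
    (by
      rintro (_ | i)
      · simp [hH]
      · exact hy.1.1 i)
    hy.1.2 (fun z hz1 hz2 => hp z (hsol z hz1 hz2)) hM0 (by
      -- A constraint violated at `z` is active at `(x₀, y₀)`: inactive ones stay negative nearby,
      -- and `f - φ` is active because `y₀` is a solution.
      filter_upwards [hslice] with z hz α β hα hsupp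
      refine hz.1 ⟨y, hy⟩ α β hα ?_
      rintro (_ | i) hi
      · simp only [solIneq]
        rw [valueFun_eq_of_mem_solMap hy₀, ← EReal.coe_sub, sub_self, EReal.coe_zero]
      · by_contra h0
        have h0' : h i x₀ y₀ ≠ 0 := fun h' => h0 (by simp [solIneq, h'])
        exact lt_asymm (hsupp _ hi) (hz.2 i h0'))
  exact ⟨α, β, h1, fun i => h2 (some i), h3, h4, h5⟩

/-- Pair `heq` with `p - y`, bound each multiplier by `M * ‖p - y‖`, and cancel one factor `‖p -
y‖`. Here `ε` measures linearization errors, incurred by at most `1 + l + q` terms. -/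
theorem norm_sub_le_of_kkt {V : Type*} [NormedAddCommGroup V] [InnerProductSpace ℝ V]
    {a : Option (Fin l) → V} {b : Fin q → V} {p y : V} {α : Option (Fin l) → ℝ} {β : Fin q → ℝ}
    {M t ε : ℝ} (hM : 0 ≤ M) (ht : 0 ≤ t) (hε : 0 ≤ ε) (hα : ∀ i, 0 ≤ α i)
    (heq : p - y = ∑ i, α i • a i + ∑ j, β j • b j)
    (hαM : ∀ i, α i ≤ M * ‖p - y‖) (hβM : ∀ j, |β j| ≤ M * ‖p - y‖)
    (hnone : inner ℝ (a none) (p - y) ≤ t + ε * ‖p - y‖)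
    (hsome : ∀ i, α (some i) ≠ 0 → inner ℝ (a (some i)) (p - y) ≤ ε * ‖p - y‖)
    (heqs : ∀ j, |inner ℝ (b j) (p - y)| ≤ ε * ‖p - y‖) :
    ‖p - y‖ ≤ M * t + M * (1 + l + q) * ε * ‖p - y‖ := by
  set d := ‖p - y‖ with hd
  have hd0 : 0 ≤ d := norm_nonneg _
  have hMd : 0 ≤ M * d := mul_nonneg hM hd0
  have hεd : 0 ≤ ε * d := mul_nonneg hε hd0
  have hsq : d * d = α none * inner ℝ (a none) (p - y) +
      ∑ i, α (some i) * inner ℝ (a (some i)) (p - y) + ∑ j, β j * inner ℝ (b j) (p - y) := by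
    have h1 : inner ℝ (p - y) (p - y) = d * d := real_inner_self_eq_norm_mul_norm _
    have h2 : ∀ u, inner ℝ (p - y) u = α none * inner ℝ (a none) u +
        ∑ i, α (some i) * inner ℝ (a (some i)) u + ∑ j, β j * inner ℝ (b j) u := fun u => by
      rw [heq, inner_add_left, sum_inner, sum_inner, Fintype.sum_option]
      simp only [real_inner_smul_left]
    rw [← h1, h2]
  have h1 : α none * inner ℝ (a none) (p - y) ≤ M * d * (t + ε * d) :=
    (mul_le_mul_of_nonneg_left hnone (hα _)).trans
      (mul_le_mul_of_nonneg_right (hαM _) (add_nonneg ht hεd))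
  have h2 : ∑ i, α (some i) * inner ℝ (a (some i)) (p - y) ≤ l * (M * d * (ε * d)) := by
    refine (Finset.sum_le_card_nsmul _ _ (M * d * (ε * d)) fun i _ => ?_).trans (by simp)
    by_cases hi : α (some i) = 0
    · rw [hi, zero_mul]
      exact mul_nonneg hMd hεd
    · exact (mul_le_mul_of_nonneg_left (hsome i hi) (hα _)).trans
        (mul_le_mul_of_nonneg_right (hαM _) hεd)
  have h3 : ∑ j, β j * inner ℝ (b j) (p - y) ≤ q * (M * d * (ε * d)) := by
    refine (Finset.sum_le_card_nsmul _ _ (M * d * (ε * d)) fun j _ => ?_).trans (by simp)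
    refine (le_abs_self _).trans ?_
    rw [abs_mul]
    exact mul_le_mul (hβM j) (heqs j) (abs_nonneg _) hMd
  rcases hd0.eq_or_lt with h0 | h0
  · rw [← h0, mul_zero, add_zero]
    exact mul_nonneg hM ht
  · refine le_of_mul_le_mul_right ?_ h0
    linarith

/-- The gradient inequalities of convex functions are global, so `ε = 0` works and `p` need not be
close to `y₀`. -/
theorem RCPLDSol.eventually_norm_sub_le_of_convexData
    (hf : ContDiff ℝ 1 fun z : Vec n × Vec m => f z.1 z.2)
    (hh : ∀ i, ContDiff ℝ 1 fun z : Vec n × Vec m => h i z.1 z.2)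
    (hg : ∀ j, ContDiff ℝ 1 fun z : Vec n × Vec m => g j z.1 z.2) (hconv : ConvexData f h g)
    {x₀ : Vec n} {y₀ : Vec m}
    (hy₀ : y₀ ∈ solMap f h g x₀) (hR : RCPLDSol f h g (dom (feasMap h g)) x₀ y₀) :
    ∃ M : ℝ, 0 ≤ M ∧ ∀ᶠ w : Vec n × Vec m in 𝓝 (x₀, y₀), w.2 ∈ solMap f h g w.1 →
      ∀ p ∈ feasMap h g w.1, (∀ z ∈ solMap f h g w.1, ‖p - w.2‖ ≤ ‖p - z‖) →
        ‖p - w.2‖ ≤ M * (f w.1 p - f w.1 w.2) := by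
  obtain ⟨M, hM, hev⟩ := hR.exists_local_kkt hf hh hg hy₀
  refine ⟨M, hM, ?_⟩
  filter_upwards [hev] with ⟨x, y⟩ hw hy p hpΓ hp
  obtain ⟨α, β, hα, hcompl, heq, hαM, hβM⟩ := hw hy p hp
  have hle := norm_sub_le_of_kkt (t := f x p - f x y) (ε := 0) hM
    (sub_nonneg.2 (hy.2 p hpΓ)) le_rfl hα heq hαM hβM
    (by
      rw [zero_mul, add_zero]
      exact inner_gradient_le_of_convexOn (hconv x).1 (hasGradientAt_right hf x y) p)
    (fun i hi => by
      refine (inner_gradient_le_of_convexOn ((hconv x).2.1 i)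
        (hasGradientAt_right (hh i) x y) p).trans ?_
      have h1 : h i x y = 0 := hcompl i hi
      rw [h1, sub_zero, zero_mul]
      exact hpΓ.1 i)
    (fun j => by
      obtain ⟨A, hA⟩ := (hconv x).2.2 j
      rw [inner_gradient_eq_of_affine hA (hasGradientAt_right (hg j) x y) p, hpΓ.2 j, hy.1.2 j]
      simp)
  simpa using hle

theorem RCPLDSol.eventually_norm_sub_le
    (hf : ContDiff ℝ 1 fun z : Vec n × Vec m => f z.1 z.2)
    (hh : ∀ i, ContDiff ℝ 1 fun z : Vec n × Vec m => h i z.1 z.2)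
    (hg : ∀ j, ContDiff ℝ 1 fun z : Vec n × Vec m => g j z.1 z.2)
    {x₀ : Vec n} {y₀ : Vec m}
    (hy₀ : y₀ ∈ solMap f h g x₀) (hR : RCPLDSol f h g (dom (feasMap h g)) x₀ y₀) :
    ∃ M : ℝ, 0 ≤ M ∧ ∀ᶠ w : Vec n × Vec m × Vec m in 𝓝 (x₀, y₀, y₀),
      w.2.1 ∈ solMap f h g w.1 → w.2.2 ∈ feasMap h g w.1 →
      (∀ z ∈ solMap f h g w.1, ‖w.2.2 - w.2.1‖ ≤ ‖w.2.2 - z‖) →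
        ‖w.2.2 - w.2.1‖ ≤ M * (f w.1 w.2.2 - f w.1 w.2.1) := by
  obtain ⟨M, hM, hev⟩ := hR.exists_local_kkt hf hh hg hy₀
  refine ⟨2 * M, by positivity, ?_⟩
  -- Small enough for the linearization errors to take at most half of `‖p - y‖`, whence the factor
  -- 2 in the constant; the `+ 1` covers `M = 0`.
  set ε : ℝ := 1 / (2 * (M * (1 + l + q) + 1)) with hε
  have hε0 : 0 < ε := by positivity
  have hεM : M * (1 + l + q) * ε ≤ 1 / 2 := by
    have hN : 0 ≤ M * (1 + l + q) := by positivity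
    rw [hε, mul_one_div, div_le_div_iff₀ (by positivity) two_pos]
    linarith
  have hc : Tendsto (fun w : Vec n × Vec m × Vec m => (w.1, w.2.1))
      (𝓝 (x₀, y₀, y₀)) (𝓝 (x₀, y₀)) := by
    have : Continuous fun w : Vec n × Vec m × Vec m => (w.1, w.2.1) := by fun_prop
    exact this.tendsto _
  filter_upwards [hc.eventually hev, eventually_abs_sub_inner_gradient_le hf x₀ y₀ hε0,
    eventually_all.2 fun i => eventually_abs_sub_inner_gradient_le (hh i) x₀ y₀ hε0,
    eventually_all.2 fun j => eventually_abs_sub_inner_gradient_le (hg j) x₀ y₀ hε0]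
    with ⟨x, y, p⟩ hw hlf hlh hlg hy hpΓ hp
  obtain ⟨α, β, hα, hcompl, heq, hαM, hβM⟩ := hw hy p hp
  dsimp only at hlf hlh hlg hy hpΓ hp hcompl heq hαM hβM ⊢
  have ht : 0 ≤ f x p - f x y := sub_nonneg.2 (hy.2 p hpΓ)
  have hle := norm_sub_le_of_kkt (t := f x p - f x y) (ε := ε) hM ht hε0.le hα heq hαM hβM
    (by
      have := (abs_le.1 hlf).1
      simp only [ineqGrad]
      linarith)
    (fun i hi => by
      have h1 := (abs_le.1 (hlh i)).1
      have h2 := hpΓ.1 i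
      have h3 := hcompl i hi
      simp only [ineqGrad]
      linarith)
    (fun j => by
      have h1 := hlg j
      rwa [hpΓ.2 j, hy.1.2 j, sub_self, zero_sub, abs_neg] at h1)
  have := mul_le_mul_of_nonneg_right hεM (norm_nonneg (p - y))
  linarith

end Solution

/-! ### Error bounds for the solution map and partial calmness -/

section Calmness

variable {n m l q : ℕ} {f : Vec n → Vec m → ℝ}
  {h : Fin l → Vec n → Vec m → ℝ} {g : Fin q → Vec n → Vec m → ℝ}

theorem InnerSemicontinuousAt.eventually_exists_norm_lt {Υ : Vec n → Set (Vec m)}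
    {Ω : Set (Vec n)} {x₀ : Vec n} {y₀ : Vec m} (hΥ : InnerSemicontinuousAt Υ Ω x₀ y₀)
    {ρ : ℝ} (hρ : 0 < ρ) : ∀ᶠ x in 𝓝 x₀, x ∈ Ω → ∃ y ∈ Υ x, ‖y - y₀‖ < ρ := by
  by_contra hcon
  obtain ⟨xs, hxs, hbad⟩ := exists_seq_forall_of_frequently (not_eventually.1 hcon)
  simp only [Classical.not_imp] at hbad
  obtain ⟨ys, hys, hmem⟩ := hΥ xs (fun k => (hbad k).1) hxs
  obtain ⟨k, hk1, hk2⟩ := (hmem.and (hys.eventually (Metric.ball_mem_nhds y₀ hρ))).exists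
  exact (hbad k).2 ⟨ys k, hk1, by rw [← dist_eq_norm]; exact hk2⟩

variable (f h g) in
/-- Local error bound for `S` on the graph of `Γ` in terms of the value function constraint. -/
def ValueErrorBoundAt (x₀ : Vec n) (y₀ : Vec m) : Prop :=
  ∃ κ : ℝ, 0 ≤ κ ∧ ∀ᶠ v : Vec n × Vec m × ℝ in 𝓝 (x₀, y₀, 0), v.2.1 ∈ feasMap h g v.1 →
    (f v.1 v.2.1 : EReal) - valueFun f h g v.1 ≤ (v.2.2 : EReal) →
    ∃ y ∈ solMap f h g v.1, ‖v.2.1 - y‖ ≤ κ * v.2.2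

theorem valueErrorBoundAt_of_innerSemicontinuousAt
    (hf : ContDiff ℝ 1 fun z : Vec n × Vec m => f z.1 z.2)
    (hh : ∀ i, ContDiff ℝ 1 fun z : Vec n × Vec m => h i z.1 z.2)
    (hg : ∀ j, ContDiff ℝ 1 fun z : Vec n × Vec m => g j z.1 z.2)
    {x₀ : Vec n} {y₀ : Vec m} (hy₀ : y₀ ∈ solMap f h g x₀)
    (hS : InnerSemicontinuousAt (solMap f h g) (dom (feasMap h g)) x₀ y₀)
    (hR : RCPLDSol f h g (dom (feasMap h g)) x₀ y₀) : ValueErrorBoundAt f h g x₀ y₀ := by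
  obtain ⟨M, hM, hev⟩ := hR.eventually_norm_sub_le hf hh hg hy₀
  obtain ⟨ε, hε, hball⟩ := Metric.eventually_nhds_iff.1 hev
  refine ⟨M, hM, ?_⟩
  -- With a solution `s` near `y₀`, `‖y - y₀‖ ≤ ‖p - s‖ + ‖p - y₀‖ ≤ 2 * ‖p - y₀‖ + ‖s - y₀‖ < ε`.
  have hε3 : 0 < ε / 3 := by positivity
  have hx := (continuous_fst.tendsto (x₀, y₀, (0 : ℝ))).eventually
    (hS.eventually_exists_norm_lt hε3)
  filter_upwards [hx, Metric.ball_mem_nhds (x₀, y₀, (0 : ℝ)) hε3] with ⟨x, p, u⟩ hxs hv hp hu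
  dsimp only at hxs hp hu ⊢
  obtain ⟨s, hs, hsn⟩ := hxs ⟨p, hp⟩
  obtain ⟨y, hy, hyp⟩ := exists_projection_solMap hf hh hg ⟨s, hs⟩ p
  rw [Metric.mem_ball, Prod.dist_eq, Prod.dist_eq] at hv
  simp only [sup_lt_iff] at hv
  refine ⟨y, hy, ?_⟩
  have hyn : ‖y - y₀‖ < ε := by
    have h1 := hyp s hs
    have h2 : ‖p - y₀‖ < ε / 3 := by rw [← dist_eq_norm]; exact hv.2.1
    have h3 : ‖p - s‖ ≤ ‖p - y₀‖ + ‖s - y₀‖ := by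
      rw [norm_sub_rev s y₀]
      exact norm_sub_le_norm_sub_add_norm_sub _ _ _
    have h4 : ‖y - y₀‖ ≤ ‖p - y‖ + ‖p - y₀‖ := by
      rw [norm_sub_rev p y]
      exact norm_sub_le_norm_sub_add_norm_sub _ _ _
    linarith
  have hdist : dist (x, y, p) (x₀, y₀, y₀) < ε := by
    rw [Prod.dist_eq, Prod.dist_eq]
    simp only [sup_lt_iff]
    exact ⟨hv.1.trans (by linarith), by rwa [dist_eq_norm], hv.2.1.trans (by linarith)⟩
  exact (hball hdist hy hp hyp).trans
    (mul_le_mul_of_nonneg_left ((sub_valueFun_le_iff hy u).1 hu) hM)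

/-- If the bound fails for every constant `k`, the projections of the violating points stay in a
bounded set and cluster at some `y₁` in `S x₀`, possibly different from `y₀`. The estimate at `y₁`
contradicts the violation, which is why RCPLD is required on all of `S x₀`. -/
theorem valueErrorBoundAt_of_convexData
    (hf : ContDiff ℝ 1 fun z : Vec n × Vec m => f z.1 z.2)
    (hh : ∀ i, ContDiff ℝ 1 fun z : Vec n × Vec m => h i z.1 z.2)
    (hg : ∀ j, ContDiff ℝ 1 fun z : Vec n × Vec m => g j z.1 z.2)
    {x₀ : Vec n} {y₀ : Vec m} (hy₀ : y₀ ∈ solMap f h g x₀) (hconv : ConvexData f h g)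
    (hbd : LocallyBoundedAt (feasMap h g) x₀)
    (hR : ∀ y ∈ solMap f h g x₀, RCPLDSol f h g (dom (feasMap h g)) x₀ y) :
    ValueErrorBoundAt f h g x₀ y₀ := by
  by_contra hcon
  simp only [ValueErrorBoundAt, not_exists, not_and, not_eventually] at hcon
  obtain ⟨D, hD, U, hU, hUD⟩ := hbd
  have hstep : ∀ k : ℕ, ∃ (x : Vec n) (p : Vec m) (u : ℝ) (y : Vec m),
      dist (x, p, u) (x₀, y₀, 0) < 1 / ((k : ℝ) + 1) ∧ x ∈ U ∧ p ∈ feasMap h g x ∧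
      y ∈ solMap f h g x ∧ (∀ z ∈ solMap f h g x, ‖p - y‖ ≤ ‖p - z‖) ∧
      f x p - f x y ≤ u ∧ k * u < ‖p - y‖ := by
    intro k
    have hx : ∀ᶠ v : Vec n × Vec m × ℝ in 𝓝 (x₀, y₀, 0), v.1 ∈ U :=
      (continuous_fst.tendsto (x₀, y₀, (0 : ℝ))).eventually hU
    obtain ⟨⟨x, p, u⟩, ⟨hbad, hxU⟩, hdist⟩ := (((hcon k (Nat.cast_nonneg k)).and_eventually
      hx).and_eventually (Metric.ball_mem_nhds (x₀, y₀, (0 : ℝ))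
        (Nat.one_div_pos_of_nat (n := k)))).exists
    simp only [Classical.not_imp, not_exists, not_and, not_le] at hbad
    obtain ⟨hp, hu, hfar⟩ := hbad
    obtain ⟨y, hy, hyp⟩ := exists_projection_solMap hf hh hg
      (solMap_nonempty_of_isBounded hf hh hg ⟨p, hp⟩ (hD.subset (hUD x hxU))) p
    exact ⟨x, p, u, y, hdist, hxU, hp, hy, hyp, (sub_valueFun_le_iff hy u).1 hu, hfar y hy⟩
  choose x p u y hdist hxU hp hy hyp hu hfar using hstep
  have hlim : Tendsto (fun k => (x k, p k, u k)) atTop (𝓝 (x₀, y₀, 0)) := by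
    rw [tendsto_iff_dist_tendsto_zero]
    exact squeeze_zero (fun _ => dist_nonneg) (fun k => (hdist k).le)
      tendsto_one_div_add_atTop_nhds_zero_nat
  have hxl : Tendsto x atTop (𝓝 x₀) := (continuous_fst.tendsto _).comp hlim
  have hpl : Tendsto p atTop (𝓝 y₀) :=
    ((continuous_fst.comp continuous_snd).tendsto _).comp hlim
  obtain ⟨y₁, -, s, hs, hsl⟩ := tendsto_subseq_of_bounded hD fun k => hUD _ (hxU k) (hy k).1
  have hsx : Tendsto (fun k => x (s k)) atTop (𝓝 x₀) := hxl.comp hs.tendsto_atTop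
  have hsp : Tendsto (fun k => p (s k)) atTop (𝓝 y₀) := hpl.comp hs.tendsto_atTop
  have hsy : Tendsto (fun k => (x (s k), y (s k))) atTop (𝓝 (x₀, y₁)) := hsx.prodMk_nhds hsl
  have hy₁ : y₁ ∈ solMap f h g x₀ := by
    refine ⟨(isClosed_feasMap hh hg).mem_of_tendsto hsy
      (Eventually.of_forall fun k => (hy (s k)).1), fun z hz => ?_⟩
    -- Optimality of `y₁` comes from comparing `y` with `p`, since `p` tends to the solution `y₀`.
    refine le_trans ?_ (hy₀.2 z hz)
    exact le_of_tendsto_of_tendsto' ((hf.continuous.tendsto (x₀, y₁)).comp hsy)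
      ((hf.continuous.tendsto (x₀, y₀)).comp (hsx.prodMk_nhds hsp))
      fun k => (hy (s k)).2 _ (hp (s k))
  obtain ⟨M, hM, hev⟩ :=
    (hR y₁ hy₁).eventually_norm_sub_le_of_convexData hf hh hg hconv hy₁
  obtain ⟨N, hN⟩ := exists_nat_ge M
  obtain ⟨k, hk, hkN⟩ := ((hsy.eventually hev).and (eventually_ge_atTop N)).exists
  have h1 := hk (hy (s k)) (p (s k)) (hp (s k)) (hyp (s k))
  dsimp only at h1
  have h2 : 0 ≤ u (s k) := (sub_nonneg.2 ((hy (s k)).2 _ (hp (s k)))).trans (hu (s k))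
  have h3 : M ≤ (s k : ℕ) := hN.trans (Nat.cast_le.2 (hkN.trans hs.le_apply))
  have h4 := mul_le_mul_of_nonneg_left (hu (s k)) hM
  have h5 := mul_le_mul_of_nonneg_right h3 h2
  linarith [hfar (s k)]

theorem ValueErrorBoundAt.partiallyCalmAt {F : Vec n → Vec m → ℝ} {X : Set (Vec n)}
    (hF : ContDiff ℝ 1 fun z : Vec n × Vec m => F z.1 z.2) {x₀ : Vec n} {y₀ : Vec m}
    (hmin : IsLocalMinimizer f h g F X x₀ y₀) (hE : ValueErrorBoundAt f h g x₀ y₀) :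
    PartiallyCalmAt f h g F X x₀ y₀ := by
  obtain ⟨κ, hκ, hev⟩ := hE
  obtain ⟨-, W, hW, hWmin⟩ := hmin
  obtain ⟨L, T, hT, hL⟩ := (hF.contDiffAt (x := (x₀, y₀))).exists_lipschitzOnWith
  obtain ⟨ε, hε, hball⟩ := Metric.mem_nhds_iff.1 (inter_mem hW hT)
  -- Chosen so that `ρ + κ * ρ = ε`: the solution `y` attached to `p` then stays within `ε` of `y₀`.
  set ρ : ℝ := ε / (1 + κ) with hρ
  have hρ0 : 0 < ρ := by positivity
  have hρκ : ρ + κ * ρ = ε := by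
    rw [hρ]; field_simp
  have hρε : ρ ≤ ε := by nlinarith
  -- Moving from `p` to `y` changes `F` by at most `L * κ * |u|`; the `+ 1` only makes the penalty
  -- parameter positive.
  refine ⟨_, inter_mem hev (Metric.ball_mem_nhds _ hρ0), L * κ + 1, by positivity, ?_⟩
  rintro x p u ⟨hxpu, hb⟩ hx hu hp
  obtain ⟨y, hy, hyp⟩ := hxpu hp hu
  dsimp only at hy hyp
  rw [Metric.mem_ball, Prod.dist_eq, Prod.dist_eq] at hb
  simp only [sup_lt_iff, dist_zero_right, Real.norm_eq_abs] at hb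
  have hyp' : dist y p ≤ κ * |u| := by
    rw [dist_comm, dist_eq_norm]
    exact hyp.trans (mul_le_mul_of_nonneg_left (le_abs_self u) hκ)
  have hyn : dist y y₀ < ε := by
    have h1 := dist_triangle y p y₀
    have h2 := mul_le_mul_of_nonneg_left hb.2.2.le hκ
    linarith [hb.2.1]
  have hmy : (x, y) ∈ W ∩ T := hball (by
    rw [Metric.mem_ball, Prod.dist_eq]
    exact max_lt (hb.1.trans_le hρε) hyn)
  have hmp : (x, p) ∈ W ∩ T := hball (by
    rw [Metric.mem_ball, Prod.dist_eq]
    exact max_lt (hb.1.trans_le hρε) (hb.2.1.trans_le hρε))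
  have h1 := hWmin x y hmy.1 hx hy
  have h2 := hL.dist_le_mul _ hmy.2 _ hmp.2
  rw [Prod.dist_eq, dist_self, max_eq_right dist_nonneg, Real.dist_eq] at h2
  have h3 := mul_le_mul_of_nonneg_left hyp' L.2
  have h4 := le_abs_self (F x y - F x p)
  have h5 := abs_nonneg u
  simp only [NNReal.val_eq_coe] at h3
  rw [add_mul, one_mul, mul_assoc]
  linarith

end Calmness

end Bilevel

end

theorem mainTheorem5 {n m l q : ℕ}
    (F f : Bilevel.Vec n → Bilevel.Vec m → ℝ)
    (h : Fin l → Bilevel.Vec n → Bilevel.Vec m → ℝ)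
    (g : Fin q → Bilevel.Vec n → Bilevel.Vec m → ℝ)
    (X : Set (Bilevel.Vec n)) (hX : IsClosed X)
    (hF : ContDiff ℝ 1 (fun z : Bilevel.Vec n × Bilevel.Vec m => F z.1 z.2))
    (hf : ContDiff ℝ 1 (fun z : Bilevel.Vec n × Bilevel.Vec m => f z.1 z.2))
    (hh : ∀ i, ContDiff ℝ 1 (fun z : Bilevel.Vec n × Bilevel.Vec m => h i z.1 z.2))
    (hg : ∀ j, ContDiff ℝ 1 (fun z : Bilevel.Vec n × Bilevel.Vec m => g j z.1 z.2))
    (x₀ : Bilevel.Vec n) (y₀ : Bilevel.Vec m)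
    (hmin : Bilevel.IsLocalMinimizer f h g F X x₀ y₀)
    (hcases :
      (Bilevel.ConvexData f h g ∧
        Bilevel.LocallyBoundedAt (Bilevel.feasMap h g) x₀ ∧
        ∀ y ∈ Bilevel.solMap f h g x₀,
          Bilevel.RCPLDSol f h g (Bilevel.dom (Bilevel.feasMap h g)) x₀ y) ∨
      (Bilevel.InnerSemicontinuousAt (Bilevel.solMap f h g)
          (Bilevel.dom (Bilevel.feasMap h g)) x₀ y₀ ∧
        Bilevel.RCPLDSol f h g (Bilevel.dom (Bilevel.feasMap h g)) x₀ y₀)) :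
    Bilevel.PartiallyCalmAt f h g F X x₀ y₀ := by
  refine Bilevel.ValueErrorBoundAt.partiallyCalmAt hF hmin ?_
  rcases hcases with ⟨hconv, hbd, hR⟩ | ⟨hS, hR⟩
  · exact Bilevel.valueErrorBoundAt_of_convexData hf hh hg hmin.1.2 hconv hbd hR
  · exact Bilevel.valueErrorBoundAt_of_innerSemicontinuousAt hf hh hg hmin.1.2 hS hR
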